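/- **Definitions.** For a set $A$ let $\mathcal F(A)$ be the set of its finite subsets. For an abelian group $H$, a mapping $\varphi\colon\mathcal F(A)\to H$ and $\beta\in\mathcal F(A)$, let $D_\beta\varphi(\alpha)=\varphi(\alpha\cup\beta)-\varphi(\alpha)$ for $\alpha\in\mathcal F(A\setminus\beta)$. The mapping $\varphi$ is *polynomial of degree $\le d$* if $D_{\beta_0}D_{\beta_1}\cdots D_{\beta_d}\varphi=0$ for all pairwise disjoint $\beta_0,\dots,\beta_d\in\mathcal F(A)$. A *VIP$_{d,r}$-set* in $\mathbb Z^l$ is a set of the form $\{\varphi(\alpha):\emptyset\ne\alpha\subseteq\{1,\dots,r\}\}$, where $\varphi\colon\mathcal F(\{1,\dots,r\})\to\mathbb Z^l$ is polynomial of degree $\le d$ with $\varphi(\emptyset)=0$. A set $E\subseteq\mathbb Z^l$ is a *VIP$^*_{d,r}$-set* if it has nonempty intersection with every VIP$_{d,r}$-set in $\mathbb Z^l$. A *generalized polynomial* $\psi\colon\mathbb Z^l\to\mathbb R$ is a mapping that is represented by an expression built from (conventional) real polynomials in $l$ variables by means of addition, change of sign, multiplication and taking the integer part $[\,\cdot\,]$.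 It is *constant-free* if it has a representation in which all the conventional polynomials involved have zero constant term, and a constant-free generalized polynomial has *total degree $\le D$* if it has such a representation in which the sum of the degrees of all the conventional polynomials involved (each counted as often as it occurs, the zero polynomial having degree $0$) does not exceed $D$. A constant-free generalized polynomial is *open* if it belongs to the ideal of the ring of constant-free generalized polynomials $\mathbb Z^l\to\mathbb R$ that is generated by the conventional polynomials with zero constant term. For $x\in\mathbb R$ let $\|x\|=\operatorname{dist}(x,\mathbb Z)$. **Theorem.** For all integers $D,d\ge 0$ and every real $\varepsilon>0$ there exists an integer $r=r(D,d,\varepsilon)\ge 0$ such that for every integer $l\ge 0$ and every open constant-free generalized polynomial $\psi\colon\mathbb Z^l\to\mathbb R$ of total degree $\le D$, the set $\{n\in\mathbb Z^l:\|\psi(n)\|<\varepsilon\}$ is a VIP$^*_{d,r}$-set. -/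

import Mathlib

/-! ### Polynomial mappings on finite sets and VIP-sets -/

/-- The `β`-derivative `D_β φ (α) = φ (α ∪ β) - φ α`; only its values at sets `α` disjoint from `β`
are ever used. -/
def setDeriv {A H : Type*} [DecidableEq A] [AddCommGroup H] (β : Finset A) (φ : Finset A → H) :
    Finset A → H :=
  fun α => φ (α ∪ β) - φ α

/-- `φ : F(A) → H` is polynomial of degree `≤ d`: for all pairwise disjoint finite sets
`β₀, …, β_d`, the mapping `D_{β₀} ⋯ D_{β_d} φ` vanishes on the finite subsets of
`A \ (β₀ ∪ ⋯ ∪ β_d)`. -/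
def IsPolyMap {A H : Type*} [DecidableEq A] [AddCommGroup H] (d : ℕ) (φ : Finset A → H) : Prop :=
  ∀ β : Fin (d + 1) → Finset A, (∀ i j, i ≠ j → Disjoint (β i) (β j)) →
    ∀ α : Finset A, (∀ i, Disjoint α (β i)) → (List.ofFn β).foldr setDeriv φ α = 0

/-- VIP_{d,r}-sets in `ℤ^l`; the set `{1, …, r}` is modelled by `Fin r`. -/
def IsVIPSet {l : ℕ} (d r : ℕ) (S : Set (Fin l → ℤ)) : Prop :=
  ∃ φ : Finset (Fin r) → (Fin l → ℤ),
    IsPolyMap d φ ∧ φ ∅ = 0 ∧ S = {n | ∃ α : Finset (Fin r), α.Nonempty ∧ φ α = n}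

/-- VIP*_{d,r}-sets in `ℤ^l`. -/
def IsVIPStarSet {l : ℕ} (d r : ℕ) (E : Set (Fin l → ℤ)) : Prop :=
  ∀ S : Set (Fin l → ℤ), IsVIPSet d r S → (E ∩ S).Nonempty

/-! ### Generalized polynomials on `ℤ^l` -/

/-- Representations of generalized polynomials `ℤ^l → ℝ`: expressions built from conventional
polynomials by addition, change of sign, multiplication and taking the integer part. -/
inductive GPRep (l : ℕ) : Type
  | poly (p : MvPolynomial (Fin l) ℝ) : GPRep l
  | add (s t : GPRep l) : GPRep l
  | neg (s : GPRep l) : GPRep l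
  | mul (s t : GPRep l) : GPRep l
  | floor (s : GPRep l) : GPRep l

/-- The mapping `ℤ^l → ℝ` given by a conventional polynomial. -/
noncomputable def polyFun {l : ℕ} (p : MvPolynomial (Fin l) ℝ) : (Fin l → ℤ) → ℝ :=
  fun n => MvPolynomial.eval (fun i => (n i : ℝ)) p

namespace GPRep

/-- The mapping `ℤ^l → ℝ` that a representation represents. -/
noncomputable def eval {l : ℕ} : GPRep l → (Fin l → ℤ) → ℝ
  | poly p => polyFun p
  | add s t => s.eval + t.eval
  | neg s => -s.eval
  | mul s t => s.eval * t.eval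
  | floor s => fun n => (⌊s.eval n⌋ : ℝ)

/-- All conventional polynomials in the representation have zero constant term. -/
def ConstFree {l : ℕ} : GPRep l → Prop
  | poly p => MvPolynomial.constantCoeff p = 0
  | add s t => s.ConstFree ∧ t.ConstFree
  | neg s => s.ConstFree
  | mul s t => s.ConstFree ∧ t.ConstFree
  | floor s => s.ConstFree

/-- The sum of the degrees of all conventional polynomials in the representation, counted with
their multiplicity of occurrence. -/
noncomputable def totalDegree {l : ℕ} : GPRep l → ℕ
  | poly p => p.totalDegree
  | add s t => s.totalDegree + t.totalDegree
  | neg s => s.totalDegree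
  | mul s t => s.totalDegree + t.totalDegree
  | floor s => s.totalDegree

end GPRep

/-- `ψ` is a constant-free generalized polynomial of total degree `≤ D`. -/
def IsConstFreeGPOfTotalDegreeLE {l : ℕ} (D : ℕ) (ψ : (Fin l → ℤ) → ℝ) : Prop :=
  ∃ t : GPRep l, t.ConstFree ∧ t.totalDegree ≤ D ∧ t.eval = ψ

/-- The (non-unital, commutative) ring of constant-free generalized polynomials `ℤ^l → ℝ`. -/
def constFreeGP (l : ℕ) : NonUnitalSubring ((Fin l → ℤ) → ℝ) where
  carrier := {ψ | ∃ t : GPRep l, t.ConstFree ∧ t.eval = ψ}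
  zero_mem' := ⟨.poly 0, by simp [GPRep.ConstFree], by
    funext n; simp [GPRep.eval, polyFun]⟩
  add_mem' := by
    rintro _ _ ⟨s, hs, rfl⟩ ⟨t, ht, rfl⟩
    exact ⟨.add s t, ⟨hs, ht⟩, rfl⟩
  neg_mem' := by
    rintro _ ⟨s, hs, rfl⟩
    exact ⟨.neg s, hs, rfl⟩
  mul_mem' := by
    rintro _ _ ⟨s, hs, rfl⟩ ⟨t, ht, rfl⟩
    exact ⟨.mul s t, ⟨hs, ht⟩, rfl⟩

/-- The ideal, in the ring of constant-free generalized polynomials, generated by the conventional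
polynomials with zero constant term. -/
def openIdeal (l : ℕ) : TwoSidedIdeal (constFreeGP l) :=
  TwoSidedIdeal.span
    {f | ∃ p : MvPolynomial (Fin l) ℝ, MvPolynomial.constantCoeff p = 0 ∧
      (f : (Fin l → ℤ) → ℝ) = polyFun p}

/-- Open constant-free generalized polynomials. -/
def IsOpenConstFreeGP {l : ℕ} (ψ : (Fin l → ℤ) → ℝ) : Prop :=
  ∃ f ∈ openIdeal l, (f : (Fin l → ℤ) → ℝ) = ψ

/-- The distance from a real number to the nearest integer. -/
noncomputable def distToInt (x : ℝ) : ℝ :=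
  Metric.infDist x (Set.range (fun k : ℤ => (k : ℝ)))

/-! A polynomial mapping `φ` on the finite subsets of `{1, …, r}` is a combination of the
monomials `α ↦ [γ ⊆ α]` with `|γ| ≤ d` (`IsPolyMap.mem_polyDeg`). In this form it is clear that real
polynomials without constant term turn polynomial mappings into polynomial mappings vanishing at
`∅`, and that the degree does not grow on a subsystem, that is, on the unions of nonempty disjoint
sets `B₁, …, B_m`.

Integer parts are handled by Ramsey theory. Let `u` be a polynomial mapping with `u ∅ = 0`, and
colour sets by the short interval containing the fractional part of `u`. The finite unions theorem
(`exists_mono_unions`) gives a subsystem on whose nonempty unions these fractional parts almost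
agree. The alternating sum of `u` over all unions vanishes, so their common value is close to an
integer `k`, and for the same reason `⌊u⌋ + k`, continued by `0` at `∅`, is again polynomial of the
same degree (`exists_subsystem_near_int`). Thus on nonempty unions `⌊u⌋` is an integer constant plus
a polynomial mapping vanishing at `∅`.

Mappings of the form "integer constant plus polynomial mapping vanishing at `∅`" are closed under
sums, products and, after passing to a subsystem, integer parts. Induction on the total degree
therefore gives a subsystem on which the generalized polynomial `ψ` along `φ` has this form,
`ψ = c + u` (`exists_isFloorStable_eval`). The number of subsystems taken is bounded in terms of `D`
although representations of total degree `≤ D` can be arbitrarily long: subexpressions of degree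
zero vanish, and iterated sign changes and integer parts of a mapping `f` only produce `±f`,
`±⌊f⌋` and `±⌊-f⌋`. A last subsystem makes `u`, hence `ψ`, `ε`-close to an integer.
-/

/-! ### Disjoint families of finite sets and the finite unions theorem -/

/-- A family of nonempty, pairwise disjoint finite sets. The unions `α.biUnion B` of its members
form a copy of the finite subsets of `κ` inside those of `ι`. -/
structure IsSubsystem {ι κ : Type*} (B : κ → Finset ι) : Prop where
  nonempty : ∀ k, (B k).Nonempty
  disjoint : ∀ j k, j ≠ k → Disjoint (B j) (B k)

theorem IsSubsystem.singleton {ι : Type*} : IsSubsystem (fun i : ι => ({i} : Finset ι)) :=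
  ⟨fun i => Finset.singleton_nonempty i, fun i j h => by simpa using h⟩

theorem IsSubsystem.comp {ι κ ν : Type*} [DecidableEq ι] {B : κ → Finset ι}
    {B' : ν → Finset κ} (hB : IsSubsystem B) (hB' : IsSubsystem B') :
    IsSubsystem (fun i => (B' i).biUnion B) := by
  refine ⟨fun i => (hB'.nonempty i).biUnion fun k _ => hB.nonempty k, fun i j hij => ?_⟩
  rw [Finset.disjoint_biUnion_left]
  intro a ha
  rw [Finset.disjoint_biUnion_right]
  intro b hb
  apply hB.disjoint
  rintro rfl
  exact Finset.disjoint_left.1 (hB'.disjoint i j hij) ha hb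

theorem IsSubsystem.biUnion_nonempty {ι κ : Type*} [DecidableEq ι] {B : κ → Finset ι}
    (hB : IsSubsystem B) {α : Finset κ} (hα : α.Nonempty) : (α.biUnion B).Nonempty :=
  hα.biUnion fun k _ => hB.nonempty k

theorem IsSubsystem.cons {ι : Type*} {k : ℕ} {A : Finset ι} {D : Fin k → Finset ι}
    (hD : IsSubsystem D) (hA : A.Nonempty) (hAD : ∀ i, Disjoint A (D i)) :
    IsSubsystem (Fin.cons A D : Fin (k + 1) → Finset ι) := by
  refine ⟨fun i => ?_, fun i j => ?_⟩
  · refine Fin.cases ?_ (fun i => ?_) i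
    · simpa using hA
    · simpa using hD.nonempty i
  · refine Fin.cases ?_ (fun i => ?_) i <;> refine Fin.cases ?_ (fun j => ?_) j
    · simp
    · simpa using fun _ => hAD j
    · simpa using (hAD i).symm
    · simpa using hD.disjoint i j

theorem mono_unions_cons {ι κ : Type*} [DecidableEq ι] (C : Finset ι → κ) {c : κ} {k : ℕ}
    {A : Finset ι} {D : Fin k → Finset ι} (hD : ∀ α : Finset (Fin k), α.Nonempty →
      C (α.biUnion D) = c) (hAD : ∀ α : Finset (Fin k), C (A ∪ α.biUnion D) = c)
    {α : Finset (Fin (k + 1))} (hα : α.Nonempty) :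
    C (α.biUnion (Fin.cons A D : Fin (k + 1) → Finset ι)) = c := by
  by_cases h0 : 0 ∈ α
  · rw [← hAD (Finset.univ.filter fun i => i.succ ∈ α)]
    congr 1
    ext x
    simp [Fin.exists_fin_succ, h0]
  · obtain ⟨i, hi⟩ := hα
    obtain ⟨j, rfl⟩ := Fin.exists_succ_eq.2 fun h : i = 0 => h0 (h ▸ hi)
    rw [← hD (Finset.univ.filter fun i => i.succ ∈ α) ⟨j, by simpa using hi⟩]
    congr 1
    ext x
    simp [Fin.exists_fin_succ, h0]

/-- The Hales–Jewett theorem over the alphabet `Bool`, in terms of finite sets. The first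
coordinate of the cube is reserved for making the constant part `A` nonempty. -/
theorem exists_mono_parameter_set (κ η : Type) [Finite κ] [Fintype η] :
    ∃ r : ℕ, ∀ C : Finset (Fin r) → κ, ∃ (c : κ) (A : Finset (Fin r)) (E : η → Finset (Fin r)),
      A.Nonempty ∧ IsSubsystem E ∧ (∀ e, Disjoint A (E e)) ∧
      ∀ β : Finset η, C (A ∪ β.biUnion E) = c := by
  classical
  obtain ⟨n, hn⟩ := Combinatorics.Subspace.exists_mono_in_high_dimension_fin Bool κ η
  refine ⟨n + 1, fun C => ?_⟩
  let S : (Fin n → Bool) → Finset (Fin (n + 1)) := fun x =>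
    insert 0 ((Finset.univ.filter fun i => x i = true).map (Fin.succEmb n))
  obtain ⟨L, c, hc⟩ := hn fun x => C (S x)
  refine ⟨c, insert 0 ((Finset.univ.filter fun i => L.idxFun i = Sum.inl true).map
    (Fin.succEmb n)), fun e => (Finset.univ.filter fun i => L.idxFun i = Sum.inr e).map
    (Fin.succEmb n), Finset.insert_nonempty _ _, ⟨fun e => ?_, fun e f hef => ?_⟩, fun e => ?_,
    fun β => ?_⟩
  · obtain ⟨i, hi⟩ := L.proper e
    exact ⟨i.succ, by simp [hi]⟩
  · rw [Finset.disjoint_map, Finset.disjoint_left]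
    simp only [Finset.mem_filter, Finset.mem_univ, true_and]
    intro i h1 h2
    rw [h1] at h2
    exact hef (Sum.inr.inj h2)
  · rw [Finset.disjoint_insert_left, Finset.disjoint_map, Finset.disjoint_left]
    simp only [Finset.mem_filter, Finset.mem_univ, true_and]
    refine ⟨by simp [Fin.succ_ne_zero], ?_⟩
    intro i h1 h2
    rw [h1] at h2
    cases h2
  · rw [← hc fun e => decide (e ∈ β)]
    congr 1
    ext j
    refine Fin.cases ?_ (fun i => ?_) j
    · simp [S]
    · have h0 : (i.succ : Fin (n + 1)) ≠ 0 := Fin.succ_ne_zero i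
      rcases hi : L.idxFun i with b | e
      · simp [S, Combinatorics.Subspace.apply_inl hi, hi, h0]
      · simp [S, Combinatorics.Subspace.apply_inr hi, hi, h0]

/-- The finite unions theorem with a separate target size `s c` for each colour `c`. The constant
part of a monochromatic parameter set of colour `c` can be added to every monochromatic subsystem
of that colour found inside the parameter set, which lowers the target for `c` by one. -/
theorem exists_mono_unions_of_targets (κ : Type) [Finite κ] (N : ℕ) : ∀ s : κ → ℕ,
    ∑ᶠ c, s c = N → ∃ r : ℕ, ∀ C : Finset (Fin r) → κ,
      ∃ (c : κ) (B : Fin (s c) → Finset (Fin r)), IsSubsystem B ∧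
        ∀ α : Finset (Fin (s c)), α.Nonempty → C (α.biUnion B) = c := by
  classical
  have := Fintype.ofFinite κ
  induction N with
  | zero =>
    intro s hs
    refine ⟨0, fun C => ?_⟩
    have h0 : s (C ∅) = 0 := by
      rw [finsum_eq_sum_of_fintype] at hs
      exact (Finset.sum_eq_zero_iff.1 hs) _ (Finset.mem_univ _)
    refine ⟨C ∅, ?_⟩
    rw [h0]
    exact ⟨Fin.elim0, ⟨fun k => k.elim0, fun k => k.elim0⟩, fun α ⟨k, _⟩ => k.elim0⟩
  | succ N ih =>
    intro s hs
    rw [finsum_eq_sum_of_fintype] at hs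
    by_cases hz : ∃ c, s c = 0
    · obtain ⟨c, hc⟩ := hz
      refine ⟨0, fun C => ⟨c, ?_⟩⟩
      rw [hc]
      exact ⟨Fin.elim0, ⟨fun k => k.elim0, fun k => k.elim0⟩, fun α ⟨k, _⟩ => k.elim0⟩
    push Not at hz
    have hsum : ∀ c, ∑ᶠ c', Function.update s c (s c - 1) c' = N := by
      intro c
      rw [finsum_eq_sum_of_fintype, Finset.sum_update_of_mem (Finset.mem_univ c)]
      rw [← Finset.add_sum_erase _ _ (Finset.mem_univ c)] at hs
      rw [← Finset.erase_eq]
      have := hz c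
      omega
    choose R hR using fun c => ih (Function.update s c (s c - 1)) (hsum c)
    obtain ⟨r, hr⟩ := exists_mono_parameter_set κ (Σ c : κ, Fin (R c))
    refine ⟨r, fun C => ?_⟩
    obtain ⟨c₀, A, E, hA, hE, hAE, hmono⟩ := hr C
    have hE' : IsSubsystem fun j : Fin (R c₀) => E ⟨c₀, j⟩ :=
      ⟨fun j => hE.nonempty _, fun i j hij => hE.disjoint _ _ (by simpa using hij)⟩
    obtain ⟨c, B, hB, hBC⟩ := hR c₀ fun β => C (β.biUnion fun j => E ⟨c₀, j⟩)
    have hBC' : ∀ α : Finset _, α.Nonempty →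
        C (α.biUnion fun i => (B i).biUnion fun j => E ⟨c₀, j⟩) = c := by
      intro α hα
      rw [← Finset.biUnion_biUnion]
      exact hBC α hα
    refine ⟨c, ?_⟩
    by_cases hc : c = c₀
    · subst hc
      obtain ⟨k, hk⟩ := Nat.exists_eq_succ_of_ne_zero (hz c)
      have hk' : Function.update s c (s c - 1) c = k := by simp [hk]
      have hD := hE'.comp hB
      generalize hDdef : (fun i => (B i).biUnion fun j => E ⟨c, j⟩) = D at hD hBC'
      have hAD : ∀ α : Finset _, C (A ∪ α.biUnion D) = c := by
        intro α
        refine Eq.trans ?_ (hmono ((α.biUnion B).image (Sigma.mk c)))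
        rw [Finset.image_biUnion, Finset.biUnion_biUnion, ← hDdef]
      have hAD' : ∀ i, Disjoint A (D i) := by
        intro i
        subst hDdef
        rw [Finset.disjoint_biUnion_right]
        exact fun j _ => hAE _
      clear hDdef hBC hB B
      generalize Function.update s c (s c - 1) c = k' at hk' D
      subst hk'
      rw [hk]
      exact ⟨Fin.cons A D, hD.cons hA hAD', fun α hα => mono_unions_cons C hBC' hAD hα⟩
    · have : s c = Function.update s c₀ (s c₀ - 1) c := by simp [hc]
      rw [this]
      exact ⟨_, hE'.comp hB, hBC'⟩

/-- The finite unions theorem (Folkman, Rado, Sanders). -/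
theorem exists_mono_unions (κ : Type) [Finite κ] (m : ℕ) :
    ∃ r : ℕ, ∀ C : Finset (Fin r) → κ, ∃ (c : κ) (B : Fin m → Finset (Fin r)),
      IsSubsystem B ∧ ∀ α : Finset (Fin m), α.Nonempty → C (α.biUnion B) = c :=
  exists_mono_unions_of_targets κ _ (fun _ => m) rfl

/-! ### Real polynomial mappings on finite sets -/

/-- The real functions on the finite subsets of `ι` that are polynomial of degree `≤ d`, as the
span of the monomials: the monomial with support `γ` is the indicator of `γ ⊆ α`. -/
def polyDeg (ι : Type*) [DecidableEq ι] (d : ℕ) : Submodule ℝ (Finset ι → ℝ) :=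
  Submodule.span ℝ {f | ∃ γ : Finset ι, γ.card ≤ d ∧ f = fun α => if γ ⊆ α then 1 else 0}

section polyDeg

variable {ι : Type*} [DecidableEq ι]

theorem indicator_mem_polyDeg {d : ℕ} {γ : Finset ι} (h : γ.card ≤ d) :
    (fun α => if γ ⊆ α then (1 : ℝ) else 0) ∈ polyDeg ι d :=
  Submodule.subset_span ⟨γ, h, rfl⟩

theorem polyDeg_mono {d e : ℕ} (h : d ≤ e) : polyDeg ι d ≤ polyDeg ι e :=
  Submodule.span_mono fun _ ⟨γ, hγ, hf⟩ => ⟨γ, hγ.trans h, hf⟩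

theorem const_mem_polyDeg (d : ℕ) (c : ℝ) : (fun _ => c) ∈ polyDeg ι d := by
  have := (polyDeg ι d).smul_mem c (indicator_mem_polyDeg (γ := ∅) (by simp))
  convert this using 1
  ext α
  simp

theorem mul_mem_polyDeg {d e : ℕ} {f g : Finset ι → ℝ} (hf : f ∈ polyDeg ι d)
    (hg : g ∈ polyDeg ι e) : f * g ∈ polyDeg ι (d + e) := by
  have h := Submodule.mul_mem_mul hf hg
  rw [polyDeg, polyDeg, Submodule.span_mul_span] at h
  refine Submodule.span_mono ?_ h
  rintro _ ⟨_, ⟨γ, hγ, rfl⟩, _, ⟨γ', hγ', rfl⟩, rfl⟩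
  refine ⟨γ ∪ γ', (Finset.card_union_le _ _).trans (add_le_add hγ hγ'), ?_⟩
  ext α
  simp only [Pi.mul_apply, Finset.union_subset_iff]
  split_ifs <;> simp_all

theorem pow_mem_polyDeg {d : ℕ} {f : Finset ι → ℝ} (hf : f ∈ polyDeg ι d) (k : ℕ) :
    f ^ k ∈ polyDeg ι (k * d) := by
  induction k with
  | zero => simpa using! const_mem_polyDeg (ι := ι) 0 1
  | succ k ih =>
    rw [pow_succ, add_mul, one_mul]
    exact mul_mem_polyDeg ih hf

theorem prod_mem_polyDeg {κ : Type*} (s : Finset κ) (e : κ → ℕ) (f : κ → Finset ι → ℝ)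
    (hf : ∀ k ∈ s, f k ∈ polyDeg ι (e k)) : ∏ k ∈ s, f k ∈ polyDeg ι (∑ k ∈ s, e k) := by
  classical
  induction s using Finset.induction_on with
  | empty => simpa using! const_mem_polyDeg (ι := ι) 0 1
  | insert a s ha ih =>
    rw [Finset.prod_insert ha, Finset.sum_insert ha]
    exact mul_mem_polyDeg (hf a (by simp)) (ih fun k hk => hf k (by simp [hk]))

/-- Passing to a subsystem does not raise the degree: a monomial with support `γ` becomes the
monomial supported by the indices of the members that meet `γ`, or zero. -/
theorem polyDeg_comp_biUnion {κ : Type*} [DecidableEq κ] [Fintype κ] {d : ℕ} {B : κ → Finset ι}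
    (hB : IsSubsystem B) {f : Finset ι → ℝ} (hf : f ∈ polyDeg ι d) :
    (fun α : Finset κ => f (α.biUnion B)) ∈ polyDeg κ d := by
  suffices h : polyDeg ι d ≤ (polyDeg κ d).comap
      (LinearMap.funLeft ℝ ℝ fun α : Finset κ => α.biUnion B) from h hf
  refine Submodule.span_le.2 ?_
  rintro _ ⟨γ, hγ, rfl⟩
  change (fun α : Finset κ => if γ ⊆ α.biUnion B then (1 : ℝ) else 0) ∈ polyDeg κ d
  by_cases hγu : γ ⊆ Finset.univ.biUnion B
  · have hη : (Finset.univ.filter fun k => (B k ∩ γ).Nonempty).card ≤ γ.card := by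
      rcases isEmpty_or_nonempty ι with _ | _
      · simp [Finset.eq_empty_of_isEmpty]
      choose! x hx using fun k (hk : (B k ∩ γ).Nonempty) => hk
      refine Finset.card_le_card_of_injOn x (fun k hk => ?_) fun j hj k hk hjk => ?_
      · exact (Finset.mem_inter.1 (hx k (by simpa using hk))).2
      · by_contra hne
        have hj := (Finset.mem_inter.1 (hx j (by simpa using hj))).1
        have hk := (Finset.mem_inter.1 (hx k (by simpa using hk))).1
        rw [← hjk] at hk
        exact Finset.disjoint_left.1 (hB.disjoint j k hne) hj hk
    convert indicator_mem_polyDeg (hη.trans hγ) using 4 with α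
    constructor
    · intro h k hk
      obtain ⟨x, hx⟩ := (Finset.mem_filter.1 hk).2
      obtain ⟨hxk, hxγ⟩ := Finset.mem_inter.1 hx
      obtain ⟨j, hj, hxj⟩ := Finset.mem_biUnion.1 (h hxγ)
      by_cases hjk : j = k
      · rwa [← hjk]
      · exact absurd hxk (Finset.disjoint_left.1 (hB.disjoint j k hjk) hxj)
    · intro h x hx
      obtain ⟨k, -, hk⟩ := Finset.mem_biUnion.1 (hγu hx)
      have hmeet : (B k ∩ γ).Nonempty := ⟨x, Finset.mem_inter.2 ⟨hk, hx⟩⟩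
      exact Finset.mem_biUnion.2 ⟨k, h (by simpa using hmeet), hk⟩
  · convert const_mem_polyDeg (ι := κ) d 0 using 2 with α
    rw [if_neg]
    exact fun h => hγu (h.trans
      (Finset.biUnion_subset_biUnion_of_subset_left B (Finset.subset_univ α)))

/-! ### Alternating sums and the characterization of the degree -/

/-- The alternating sum of `f` over the cube of sets between `β` and `β ∪ γ`: up to sign, the
iterated derivative of `f` at `β` in the directions `{a}`, `a ∈ γ`. -/
def altSum (γ : Finset ι) (f : Finset ι → ℝ) (β : Finset ι) : ℝ :=
  ∑ δ ∈ γ.powerset, (-1) ^ δ.card * f (β ∪ δ)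

theorem altSum_insert {a : ι} {γ : Finset ι} (ha : a ∉ γ) (f : Finset ι → ℝ) (β : Finset ι) :
    altSum (insert a γ) f β = altSum γ f β - altSum γ f (insert a β) := by
  rw [altSum, Finset.sum_powerset_insert ha, altSum, altSum, sub_eq_add_neg,
    ← Finset.sum_neg_distrib]
  congr 1
  refine Finset.sum_congr rfl fun δ hδ => ?_
  rw [Finset.card_insert_of_notMem fun h => ha (Finset.mem_powerset.1 hδ h), Finset.union_insert,
    Finset.insert_union]
  ring

theorem altSum_sub (γ : Finset ι) (f g : Finset ι → ℝ) (β : Finset ι) :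
    altSum γ (f - g) β = altSum γ f β - altSum γ g β := by
  simp only [altSum, Pi.sub_apply, mul_sub, Finset.sum_sub_distrib]

theorem abs_altSum_le {γ : Finset ι} {f : Finset ι → ℝ} {β : Finset ι} {δ : ℝ}
    (h : ∀ α, |f α| ≤ δ) : |altSum γ f β| ≤ 2 ^ γ.card * δ := by
  calc |altSum γ f β| ≤ ∑ η ∈ γ.powerset, |(-1) ^ η.card * f (β ∪ η)| :=
        Finset.abs_sum_le_sum_abs _ _
    _ ≤ ∑ η ∈ γ.powerset, δ := Finset.sum_le_sum fun η _ => by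
        simpa [abs_mul] using h (β ∪ η)
    _ = 2 ^ γ.card * δ := by simp

theorem exists_int_eq_altSum {γ : Finset ι} {f : Finset ι → ℝ} {β : Finset ι}
    (h : ∀ α, ∃ z : ℤ, f α = z) : ∃ z : ℤ, altSum γ f β = z := by
  choose z hz using h
  exact ⟨∑ δ ∈ γ.powerset, (-1) ^ δ.card * z (β ∪ δ), by simp [altSum, hz]⟩

/-- Möbius inversion on finite sets. -/
theorem eq_sum_altSum (f : Finset ι → ℝ) (α β : Finset ι) :
    f (β ∪ α) = ∑ γ ∈ α.powerset, (-1) ^ γ.card * altSum γ f β := by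
  induction α using Finset.induction_on generalizing β with
  | empty => simp [altSum]
  | insert a α ha ih =>
    rw [Finset.sum_powerset_insert ha, ← Finset.sum_add_distrib, Finset.union_insert,
      ← Finset.insert_union, ih]
    refine Finset.sum_congr rfl fun γ hγ => ?_
    have haγ : a ∉ γ := fun h => ha (Finset.mem_powerset.1 hγ h)
    rw [Finset.card_insert_of_notMem haγ, altSum_insert haγ]
    ring

theorem mem_polyDeg_of_altSum_eq_zero [Fintype ι] {d : ℕ} {f : Finset ι → ℝ}
    (h : ∀ γ : Finset ι, d < γ.card → altSum γ f ∅ = 0) : f ∈ polyDeg ι d := by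
  have hf : f = ∑ γ : Finset ι, ((-1) ^ γ.card * altSum γ f ∅) •
      fun α : Finset ι => if γ ⊆ α then (1 : ℝ) else 0 := by
    ext α
    have := eq_sum_altSum f α ∅
    rw [Finset.empty_union] at this
    simp only [this, Finset.sum_apply, Pi.smul_apply, smul_eq_mul, mul_ite, mul_one, mul_zero]
    rw [← Finset.sum_filter]
    refine Finset.sum_congr ?_ fun _ _ => rfl
    ext γ
    simp
  rw [hf]
  refine Submodule.sum_mem _ fun γ _ => ?_
  by_cases hγ : γ.card ≤ d
  · exact Submodule.smul_mem _ _ (indicator_mem_polyDeg hγ)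
  · rw [h γ (not_le.1 hγ)]
    simp

theorem altSum_eq_zero_of_mem_polyDeg {d : ℕ} {f : Finset ι → ℝ} (hf : f ∈ polyDeg ι d)
    {γ : Finset ι} (hγ : d < γ.card) : altSum γ f ∅ = 0 := by
  induction hf using Submodule.span_induction with
  | mem f hf =>
    obtain ⟨η, hη, rfl⟩ := hf
    obtain ⟨a, haγ, haη⟩ := Finset.exists_mem_notMem_of_card_lt_card (hη.trans_lt hγ)
    rw [← Finset.insert_erase haγ, altSum_insert (Finset.notMem_erase a γ), sub_eq_zero]
    refine Finset.sum_congr rfl fun δ _ => ?_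
    rw [Finset.insert_union]
    simp only [Finset.subset_insert_iff_of_notMem haη]
  | zero => simp [altSum]
  | add f g _ _ hf hg =>
    rw [altSum] at hf hg ⊢
    simp only [Pi.add_apply, mul_add, Finset.sum_add_distrib, hf, hg, add_zero]
  | smul c f _ hf =>
    rw [altSum] at hf ⊢
    simp only [Pi.smul_apply, smul_eq_mul, mul_left_comm _ c, ← Finset.mul_sum, hf, mul_zero]

theorem altSum_eq_zero_of_subset {γ₀ γ : Finset ι} (h : γ₀ ⊆ γ) {f : Finset ι → ℝ}
    (hf : ∀ β, Disjoint β γ₀ → altSum γ₀ f β = 0) {β : Finset ι} (hβ : Disjoint β γ) :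
    altSum γ f β = 0 := by
  obtain ⟨η, hη, rfl⟩ : ∃ η, Disjoint η γ₀ ∧ γ = η ∪ γ₀ :=
    ⟨γ \ γ₀, Finset.sdiff_disjoint, (Finset.sdiff_union_of_subset h).symm⟩
  clear h
  induction η using Finset.induction_on generalizing β with
  | empty => rw [Finset.empty_union] at hβ ⊢; exact hf β hβ
  | insert a η ha ih =>
    rw [Finset.disjoint_insert_left] at hη
    rw [Finset.insert_union, Finset.disjoint_insert_right] at hβ
    have ha' : a ∉ η ∪ γ₀ := by simp [ha, hη.1]
    rw [Finset.insert_union, altSum_insert ha', ih hη.2 hβ.2, ih hη.2, sub_zero]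
    rw [Finset.disjoint_insert_left]
    exact ⟨ha', hβ.2⟩

theorem foldr_setDeriv_singletons (f : Finset ι → ℝ) (L : List ι) (hL : L.Nodup) (β : Finset ι) :
    (L.map fun a => ({a} : Finset ι)).foldr setDeriv f β =
      (-1) ^ L.length * altSum L.toFinset f β := by
  induction L generalizing β with
  | nil => simp [altSum]
  | cons a L ih =>
    rw [List.nodup_cons] at hL
    rw [List.map_cons, List.foldr_cons, setDeriv, ih hL.2, ih hL.2, List.toFinset_cons,
      altSum_insert (by simpa using hL.1), List.length_cons, Finset.union_comm β {a},
      ← Finset.insert_eq]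
    ring

theorem IsPolyMap.mem_polyDeg [Fintype ι] {d : ℕ} {f : Finset ι → ℝ} (hf : IsPolyMap d f) :
    f ∈ polyDeg ι d := by
  refine mem_polyDeg_of_altSum_eq_zero fun γ hγ => ?_
  obtain ⟨γ₀, hγ₀, hcard⟩ := Finset.exists_subset_card_eq (Nat.succ_le_of_lt hγ)
  refine altSum_eq_zero_of_subset hγ₀ (fun β hβ => ?_) (Finset.disjoint_empty_left γ)
  let e : Fin (d + 1) ≃ γ₀ := (γ₀.equivFinOfCardEq hcard).symm
  have h := hf (fun i => {(e i : ι)}) (fun i j hij => by simpa [Subtype.ext_iff] using hij) β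
    fun i => by simpa using Finset.disjoint_right.1 hβ (e i).2
  have hL : List.ofFn (fun i => ({(e i : ι)} : Finset ι)) =
      (List.ofFn fun i => (e i : ι)).map fun a => {a} := by
    rw [List.map_ofFn]
    rfl
  have hL' : (List.ofFn fun i => (e i : ι)).toFinset = γ₀ := by
    ext x
    simp only [List.mem_toFinset, List.mem_ofFn]
    exact ⟨fun ⟨i, hi⟩ => hi ▸ (e i).2, fun hx => ⟨e.symm ⟨x, hx⟩, by simp⟩⟩
  have hnodup : (List.ofFn fun i => (e i : ι)).Nodup :=
    List.nodup_ofFn.2 (Subtype.val_injective.comp e.injective)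
  rw [hL, foldr_setDeriv_singletons _ _ hnodup, hL'] at h
  simpa using h

end polyDeg

theorem IsPolyMap.map {A H H' : Type*} [DecidableEq A] [AddCommGroup H] [AddCommGroup H'] {d : ℕ}
    {φ : Finset A → H} (hφ : IsPolyMap d φ) (g : H →+ H') : IsPolyMap d fun α => g (φ α) := by
  have key : ∀ (L : List (Finset A)) (α : Finset A),
      L.foldr setDeriv (fun α => g (φ α)) α = g (L.foldr setDeriv φ α) := by
    intro L
    induction L with
    | nil => intro α; rfl
    | cons β L ih => intro α; simp only [List.foldr_cons, setDeriv, ih, map_sub]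
  intro β hβ α hα
  rw [key, hφ β hβ α hα, map_zero]

/-! ### Integer parts of polynomial mappings -/

/-- If the fractional parts of a polynomial mapping `u` with `u ∅ = 0` are nearly constant on
nonempty sets, then that constant is nearly an integer `k`, and `⌊u⌋ + k` is, on nonempty sets,
an integer-valued polynomial mapping of the same degree. Both facts come from the vanishing of the
alternating sums of `u`: an integer which is less than `1` in absolute value is zero. -/
theorem exists_polyDeg_of_fract_near {ι : Type*} [DecidableEq ι] [Fintype ι] {e : ℕ}
    (he : e < Fintype.card ι) {u : Finset ι → ℝ} (hu : u ∈ polyDeg ι e) (hu0 : u ∅ = 0) {θ η : ℝ}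
    (hη : 0 ≤ η) (hη1 : 2 ^ Fintype.card ι * ((2 ^ Fintype.card ι + 1) * η) < 1)
    (hθ : ∀ α : Finset ι, α.Nonempty → |Int.fract (u α) - θ| ≤ η) :
    ∃ (k : ℤ) (w : Finset ι → ℝ), w ∈ polyDeg ι e ∧ w ∅ = 0 ∧
      (∀ α : Finset ι, α.Nonempty → w α = ⌊u α⌋ + k) ∧
      ∀ α, |u α - w α| ≤ (2 ^ Fintype.card ι + 1) * η := by
  set M := Fintype.card ι with hM
  let h : Finset ι → ℝ := fun α => if α = ∅ then 0 else Int.fract (u α) - θ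
  let z : Finset ι → ℝ := fun α => if α = ∅ then 0 else ⌊u α⌋
  have hh : ∀ α, |h α| ≤ η := by
    intro α
    by_cases hα : α = ∅
    · simpa [h, hα] using hη
    · simpa [h, hα] using hθ α (Finset.nonempty_iff_ne_empty.2 hα)
  obtain ⟨k, hk⟩ : ∃ k : ℤ, altSum Finset.univ z ∅ = k := by
    refine exists_int_eq_altSum fun α => ?_
    by_cases hα : α = ∅
    · exact ⟨0, by simp [z, hα]⟩
    · exact ⟨⌊u α⌋, by simp [z, hα]⟩
  have hsum : altSum Finset.univ (u - z - h) ∅ = -θ := by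
    have h1 : ∀ δ : Finset ι, (u - z - h) δ = θ - if δ = ∅ then θ else 0 := by
      intro δ
      by_cases hδ : δ = ∅
      · simp [z, h, hδ, hu0]
      · simp only [Pi.sub_apply, z, h, hδ, if_false, ← Int.self_sub_floor]
        ring
    have hne : (Finset.univ : Finset ι).Nonempty := by
      rw [← Finset.card_pos, Finset.card_univ]
      omega
    have h2 : ∑ δ ∈ (Finset.univ : Finset ι).powerset, (-1 : ℝ) ^ δ.card = 0 := by
      exact_mod_cast Finset.sum_powerset_neg_one_pow_card_of_nonempty hne
    simp only [altSum, Finset.empty_union, h1, mul_sub, Finset.sum_sub_distrib, ← Finset.sum_mul,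
      h2]
    simp
  have hθk : |θ - k| ≤ 2 ^ M * η := by
    rw [altSum_sub, altSum_sub, altSum_eq_zero_of_mem_polyDeg hu (by simpa using he), hk] at hsum
    have h3 : θ - k = altSum Finset.univ h ∅ := by linarith
    rw [h3]
    simpa using abs_altSum_le (γ := Finset.univ) (β := ∅) hh
  let w : Finset ι → ℝ := fun α => if α = ∅ then 0 else ⌊u α⌋ + k
  have hw : ∀ α, |u α - w α| ≤ (2 ^ M + 1) * η := by
    intro α
    by_cases hα : α = ∅
    · simp only [w, hα, hu0, if_true, sub_zero, abs_zero]
      positivity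
    · have h4 : u α - w α = (Int.fract (u α) - θ) + (θ - k) := by
        simp only [w, hα, if_false, ← Int.self_sub_floor]
        ring
      rw [h4]
      refine (abs_add_le _ _).trans ?_
      linarith [hθ α (Finset.nonempty_iff_ne_empty.2 hα)]
  refine ⟨k, w, mem_polyDeg_of_altSum_eq_zero fun γ hγ => ?_, by simp [w],
    fun α hα => by simp [w, hα.ne_empty], hw⟩
  obtain ⟨n, hn⟩ : ∃ n : ℤ, altSum γ w ∅ = n := by
    refine exists_int_eq_altSum fun α => ?_
    by_cases hα : α = ∅
    · exact ⟨0, by simp [w, hα]⟩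
    · exact ⟨⌊u α⌋ + k, by simp [w, hα]⟩
  have h5 : |altSum γ (u - w) ∅| < 1 := by
    refine (abs_altSum_le hw).trans_lt (lt_of_le_of_lt ?_ hη1)
    refine mul_le_mul_of_nonneg_right ?_ (by positivity)
    exact pow_le_pow_right₀ one_le_two (Finset.card_le_univ γ)
  rw [altSum_sub, altSum_eq_zero_of_mem_polyDeg hu hγ, zero_sub, abs_neg, hn] at h5
  rw [hn]
  exact_mod_cast Int.abs_lt_one_iff.1 (by exact_mod_cast h5)

/-- On some subsystem, a polynomial mapping `u` with `u ∅ = 0` is within `δ` of an integer-valued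
polynomial mapping `w`, which differs from `⌊u⌋` by a constant. The finite unions theorem is applied
to the colouring of a set by the short interval that contains the fractional part of `u`. -/
theorem exists_subsystem_near_int (e m : ℕ) {δ : ℝ} (hδ : 0 < δ) :
    ∃ r : ℕ, ∀ u ∈ polyDeg (Fin r) e, u ∅ = 0 →
      ∃ B : Fin m → Finset (Fin r), IsSubsystem B ∧
        ∃ (k : ℤ) (w : Finset (Fin m) → ℝ), w ∈ polyDeg (Fin m) e ∧ w ∅ = 0 ∧
          (∀ α : Finset (Fin m), α.Nonempty → w α = ⌊u (α.biUnion B)⌋ + k) ∧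
          ∀ α, |u (α.biUnion B) - w α| < δ := by
  -- `exists_polyDeg_of_fract_near` needs more than `e` indices.
  let M := m + (e + 1)
  obtain ⟨N, hN⟩ := exists_nat_gt (2 ^ M * (2 ^ M + 1) + (2 ^ M + 1) / δ : ℝ)
  have hN0 : (0 : ℝ) < N := lt_of_le_of_lt (by positivity) hN
  have hN1 : (2 : ℝ) ^ M * ((2 ^ M + 1) * (1 / N)) < 1 := by
    rw [← mul_assoc, mul_one_div, div_lt_one hN0]
    have : (0 : ℝ) < (2 ^ M + 1) / δ := by positivity
    linarith
  have hN2 : ((2 : ℝ) ^ M + 1) * (1 / N) < δ := by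
    rw [mul_one_div, div_lt_iff₀ hN0, ← div_lt_iff₀' hδ]
    have : (0 : ℝ) < 2 ^ M * (2 ^ M + 1) := by positivity
    linarith
  obtain ⟨r, hr⟩ := exists_mono_unions (Fin N) M
  refine ⟨r, fun u hu hu0 => ?_⟩
  have hcol : ∀ x : ℝ, ⌊Int.fract x * N⌋₊ < N := by
    intro x
    rw [Nat.floor_lt (mul_nonneg (Int.fract_nonneg x) hN0.le)]
    exact mul_lt_of_lt_one_left hN0 (Int.fract_lt_one x)
  obtain ⟨c, B, hB, hc⟩ := hr fun α => ⟨⌊Int.fract (u α) * N⌋₊, hcol (u α)⟩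
  have hnear : ∀ α : Finset (Fin M), α.Nonempty →
      |Int.fract (u (α.biUnion B)) - (c : ℕ) / N| ≤ 1 / N := by
    intro α hα
    have h1 : ⌊Int.fract (u (α.biUnion B)) * N⌋₊ = (c : ℕ) := congrArg Fin.val (hc α hα)
    have h2 := Nat.floor_le (mul_nonneg (Int.fract_nonneg (u (α.biUnion B))) hN0.le)
    have h3 := (Nat.lt_floor_add_one (Int.fract (u (α.biUnion B)) * N)).le
    rw [h1] at h2 h3
    have h4 : Int.fract (u (α.biUnion B)) - (c : ℕ) / N =
        (Int.fract (u (α.biUnion B)) * N - (c : ℕ)) / N := by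
      field_simp
    rw [h4, abs_div, abs_of_pos hN0]
    refine div_le_div_of_nonneg_right ?_ hN0.le
    rw [abs_le]
    constructor <;> linarith
  have hcard : e < Fintype.card (Fin M) := by
    rw [Fintype.card_fin]
    omega
  obtain ⟨k, w, hw, hw0, hwk, hwu⟩ := exists_polyDeg_of_fract_near hcard
    (polyDeg_comp_biUnion hB hu) (by simpa using hu0) (by positivity) (by simpa using hN1) hnear
  have hI : IsSubsystem fun i : Fin m => ({Fin.castAdd (e + 1) i} : Finset (Fin M)) :=
    ⟨fun i => Finset.singleton_nonempty _, fun i j hij => by simpa using hij⟩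
  refine ⟨_, hB.comp hI, k, _, polyDeg_comp_biUnion hI hw, by simpa using hw0, fun α hα => ?_,
    fun α => ?_⟩
  · rw [hwk _ (hI.biUnion_nonempty hα), Finset.biUnion_biUnion]
  · rw [← Finset.biUnion_biUnion]
    exact (hwu _).trans_lt (by simpa using hN2)

/-! ### Generalized polynomials along subsystems -/

/-- On nonempty sets, `f` is the sum of an integer constant and a polynomial mapping of degree
`≤ e` that vanishes at `∅`. -/
def IsAlmostPoly {ι : Type*} [DecidableEq ι] (e : ℕ) (f : Finset ι → ℝ) : Prop :=
  ∃ (c : ℤ) (u : Finset ι → ℝ), u ∈ polyDeg ι e ∧ u ∅ = 0 ∧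
    ∀ α : Finset ι, α.Nonempty → f α = c + u α

namespace IsAlmostPoly

variable {ι : Type*} [DecidableEq ι] {e e' : ℕ} {f g : Finset ι → ℝ}

theorem zero (e : ℕ) : IsAlmostPoly e (0 : Finset ι → ℝ) :=
  ⟨0, 0, zero_mem _, rfl, fun _ _ => by simp⟩

theorem mono (h : e ≤ e') (hf : IsAlmostPoly e f) : IsAlmostPoly e' f := by
  obtain ⟨c, u, hu, hu0, hf⟩ := hf
  exact ⟨c, u, polyDeg_mono h hu, hu0, hf⟩

theorem neg (hf : IsAlmostPoly e f) : IsAlmostPoly e (-f) := by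
  obtain ⟨c, u, hu, hu0, hf⟩ := hf
  refine ⟨-c, -u, neg_mem hu, by simp [hu0], fun α hα => ?_⟩
  simp only [Pi.neg_apply, hf α hα, Int.cast_neg]
  ring

theorem add (hf : IsAlmostPoly e f) (hg : IsAlmostPoly e g) : IsAlmostPoly e (f + g) := by
  obtain ⟨c, u, hu, hu0, hf⟩ := hf
  obtain ⟨b, v, hv, hv0, hg⟩ := hg
  refine ⟨c + b, u + v, add_mem hu hv, by simp [hu0, hv0], fun α hα => ?_⟩
  simp only [Pi.add_apply, hf α hα, hg α hα, Int.cast_add]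
  ring

theorem mul (hf : IsAlmostPoly e f) (hg : IsAlmostPoly e' g) :
    IsAlmostPoly (e + e') (f * g) := by
  obtain ⟨c, u, hu, hu0, hf⟩ := hf
  obtain ⟨b, v, hv, hv0, hg⟩ := hg
  refine ⟨c * b, (c : ℝ) • v + (b : ℝ) • u + u * v, add_mem (add_mem
    (Submodule.smul_mem _ _ (polyDeg_mono (Nat.le_add_left e' e) hv))
    (Submodule.smul_mem _ _ (polyDeg_mono (Nat.le_add_right e e') hu))) (mul_mem_polyDeg hu hv),
    by simp [hu0, hv0], fun α hα => ?_⟩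
  simp only [Pi.mul_apply, Pi.add_apply, Pi.smul_apply, smul_eq_mul, hf α hα, hg α hα,
    Int.cast_mul]
  ring

theorem comp_biUnion {κ : Type*} [DecidableEq κ] [Fintype κ] {B : κ → Finset ι}
    (hB : IsSubsystem B) (hf : IsAlmostPoly e f) :
    IsAlmostPoly e fun α : Finset κ => f (α.biUnion B) := by
  obtain ⟨c, u, hu, hu0, hf⟩ := hf
  exact ⟨c, _, polyDeg_comp_biUnion hB hu, by simpa using hu0,
    fun α hα => hf _ (hB.biUnion_nonempty hα)⟩

end IsAlmostPoly

theorem exists_isAlmostPoly_floor (e m : ℕ) :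
    ∃ r : ℕ, ∀ f : Finset (Fin r) → ℝ, IsAlmostPoly e f →
      ∃ B : Fin m → Finset (Fin r), IsSubsystem B ∧
        IsAlmostPoly e fun α => (⌊f (α.biUnion B)⌋ : ℝ) := by
  obtain ⟨r, hr⟩ := exists_subsystem_near_int e m one_pos
  refine ⟨r, fun f ⟨c, u, hu, hu0, hf⟩ => ?_⟩
  obtain ⟨B, hB, k, w, hw, hw0, hwk, -⟩ := hr u hu hu0
  refine ⟨B, hB, c - k, w, hw, hw0, fun α hα => ?_⟩
  beta_reduce
  rw [hf _ (hB.biUnion_nonempty hα), hwk α hα, Int.floor_intCast_add]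
  push_cast
  ring

/-- `f` remains almost polynomial under any sequence of sign changes and integer parts. Two integer
parts have to be recorded: since `⌊±⌊f⌋⌋ = ±⌊f⌋`, further ones contribute nothing new. -/
structure IsFloorStable {ι : Type*} [DecidableEq ι] (e : ℕ) (f : Finset ι → ℝ) : Prop where
  self : IsAlmostPoly e f
  floor : IsAlmostPoly e fun α => (⌊f α⌋ : ℝ)
  floor_neg : IsAlmostPoly e fun α => (⌊-f α⌋ : ℝ)

namespace IsFloorStable

variable {ι : Type*} [DecidableEq ι] {e : ℕ} {f : Finset ι → ℝ}

theorem zero (e : ℕ) : IsFloorStable e (0 : Finset ι → ℝ) :=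
  ⟨.zero e, by simpa using! IsAlmostPoly.zero e, by simpa using! IsAlmostPoly.zero e⟩

theorem neg (hf : IsFloorStable e f) : IsFloorStable e (-f) :=
  ⟨hf.self.neg, hf.floor_neg, by simpa using hf.floor⟩

theorem floor' (hf : IsFloorStable e f) : IsFloorStable e fun α => (⌊f α⌋ : ℝ) := by
  refine ⟨hf.floor, by simpa using hf.floor, ?_⟩
  convert hf.floor.neg using 2 with α
  rw [← Int.cast_neg, Int.floor_intCast, Int.cast_neg]
  rfl

end IsFloorStable

theorem exists_isFloorStable (e m : ℕ) :
    ∃ r : ℕ, ∀ f : Finset (Fin r) → ℝ, IsAlmostPoly e f →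
      ∃ B : Fin m → Finset (Fin r), IsSubsystem B ∧ IsFloorStable e fun α => f (α.biUnion B) := by
  obtain ⟨r₁, hr₁⟩ := exists_isAlmostPoly_floor e m
  obtain ⟨r, hr⟩ := exists_isAlmostPoly_floor e r₁
  refine ⟨r, fun f hf => ?_⟩
  obtain ⟨B, hB, hfB⟩ := hr f hf
  obtain ⟨B', hB', hfB'⟩ := hr₁ _ (hf.comp_biUnion hB).neg
  refine ⟨_, hB.comp hB', ?_⟩
  simp only [← Finset.biUnion_biUnion]
  exact ⟨(hf.comp_biUnion hB).comp_biUnion hB', hfB.comp_biUnion hB', hfB'⟩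

theorem GPRep.eval_eq_zero {l : ℕ} (t : GPRep l) (ht : t.ConstFree) (h : t.totalDegree = 0) :
    t.eval = 0 := by
  induction t with
  | poly p =>
    obtain ⟨c, rfl⟩ : ∃ c, p = MvPolynomial.C c :=
      ⟨_, MvPolynomial.totalDegree_eq_zero_iff_eq_C.1 h⟩
    obtain rfl : c = 0 := by simpa [ConstFree] using ht
    funext n
    simp [eval, polyFun]
  | add s t hs ht' =>
    obtain ⟨h1, h2⟩ := Nat.add_eq_zero_iff.1 h
    simp [eval, hs ht.1 h1, ht' ht.2 h2]
  | neg s hs => simp [eval, hs ht h]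
  | mul s t hs _ => simp [eval, hs ht.1 (Nat.add_eq_zero_iff.1 h).1]
  | floor s hs =>
    funext n
    simp [eval, hs ht h]

/-- A real polynomial without constant term, evaluated along a polynomial mapping into `ℤ^l`. -/
theorem isAlmostPoly_polyFun {ι : Type*} [DecidableEq ι] {l d : ℕ}
    {p : MvPolynomial (Fin l) ℝ} (hp : MvPolynomial.constantCoeff p = 0)
    {φ : Finset ι → Fin l → ℤ} (hφ : ∀ i, (fun α => (φ α i : ℝ)) ∈ polyDeg ι d) (hφ0 : φ ∅ = 0) :
    IsAlmostPoly (p.totalDegree * d) fun α => polyFun p (φ α) := by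
  refine ⟨0, fun α => polyFun p (φ α), ?_, ?_, fun α _ => by simp⟩
  · have h : (fun α => polyFun p (φ α)) = ∑ s ∈ p.support, p.coeff s •
        ∏ i, (fun α => (φ α i : ℝ)) ^ s i := by
      ext α
      simp [polyFun, MvPolynomial.eval_eq', Finset.sum_apply, Finset.prod_apply]
    rw [h]
    refine Submodule.sum_mem _ fun s hs => Submodule.smul_mem _ _ ?_
    refine polyDeg_mono ?_ (prod_mem_polyDeg Finset.univ (fun i => s i * d) _
      fun i _ => pow_mem_polyDeg (hφ i) (s i))
    rw [← Finset.sum_mul]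
    refine Nat.mul_le_mul_right d ?_
    have := MvPolynomial.le_totalDegree hs
    rwa [Finsupp.sum_fintype _ _ fun _ => rfl] at this
  · simpa [polyFun, hφ0, ← MvPolynomial.constantCoeff_eq] using hp

/-- Along a polynomial mapping, a constant-free generalized polynomial is almost polynomial on some
subsystem, whose size depends only on the degrees. Subexpressions of total degree zero vanish, so
sums and products either reduce to one of their terms or consist of two terms of smaller total
degree; sign changes and integer parts are absorbed by `IsFloorStable`. -/
theorem exists_isFloorStable_eval (d D : ℕ) : ∀ m : ℕ, ∃ r : ℕ, ∀ (l : ℕ) (t : GPRep l),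
    t.ConstFree → t.totalDegree ≤ D → ∀ φ : Finset (Fin r) → Fin l → ℤ,
      (∀ i, (fun α => (φ α i : ℝ)) ∈ polyDeg (Fin r) d) → φ ∅ = 0 →
        ∃ B : Fin m → Finset (Fin r), IsSubsystem B ∧
          IsFloorStable (2 ^ D * d) fun α => t.eval (φ (α.biUnion B)) := by
  induction D with
  | zero =>
    refine fun m => ⟨m, fun l t ht htD φ _ _ => ⟨_, IsSubsystem.singleton, ?_⟩⟩
    rw [t.eval_eq_zero ht (Nat.le_zero.1 htD)]
    exact IsFloorStable.zero _
  | succ D ih =>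
    intro m
    obtain ⟨r₂, hr₂⟩ := exists_isFloorStable (2 ^ (D + 1) * d) m
    obtain ⟨r₁, hr₁⟩ := ih r₂
    obtain ⟨r, hr⟩ := ih r₁
    refine ⟨r, fun l t ht htD φ hφ hφ0 => ?_⟩
    have pair : ∀ s t : GPRep l, s.ConstFree → t.ConstFree → s.totalDegree ≤ D →
        t.totalDegree ≤ D → ∃ B : Fin r₂ → Finset (Fin r), IsSubsystem B ∧
          IsAlmostPoly (2 ^ D * d) (fun α => s.eval (φ (α.biUnion B))) ∧
          IsAlmostPoly (2 ^ D * d) (fun α => t.eval (φ (α.biUnion B))) := by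
      intro s t hs ht hsD htD
      obtain ⟨B, hB, hsB⟩ := hr l s hs hsD φ hφ hφ0
      obtain ⟨B', hB', htB'⟩ := hr₁ l t ht htD (fun α => φ (α.biUnion B))
        (fun i => polyDeg_comp_biUnion hB (hφ i)) (by simpa using hφ0)
      refine ⟨_, hB.comp hB', ?_⟩
      simp only [← Finset.biUnion_biUnion]
      exact ⟨hsB.self.comp_biUnion hB', htB'.self⟩
    have stable : ∀ (f : (Fin l → ℤ) → ℝ) (B : Fin r₂ → Finset (Fin r)), IsSubsystem B →
        IsAlmostPoly (2 ^ (D + 1) * d) (fun α => f (φ (α.biUnion B))) →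
        ∃ B : Fin m → Finset (Fin r), IsSubsystem B ∧
          IsFloorStable (2 ^ (D + 1) * d) fun α => f (φ (α.biUnion B)) := by
      intro f B hB hf
      obtain ⟨B', hB', hfB'⟩ := hr₂ _ hf
      refine ⟨_, hB.comp hB', ?_⟩
      simpa only [← Finset.biUnion_biUnion] using hfB'
    induction t with
    | poly p =>
      -- The zero polynomial serves only to supply some subsystem of the required size.
      obtain ⟨B, hB, -⟩ := pair (.poly 0) (.poly 0) (by simp [GPRep.ConstFree])
        (by simp [GPRep.ConstFree]) (by simp [GPRep.totalDegree]) (by simp [GPRep.totalDegree])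
      refine stable _ B hB ((isAlmostPoly_polyFun ht
        (fun i => polyDeg_comp_biUnion hB (hφ i)) (by simpa using hφ0)).mono ?_)
      exact Nat.mul_le_mul_right d (le_trans htD Nat.lt_two_pow_self.le)
    | add s t hs ht' =>
      have hst : s.totalDegree + t.totalDegree ≤ D + 1 := htD
      rcases Nat.eq_zero_or_pos s.totalDegree with h | h
      · simpa [GPRep.eval, s.eval_eq_zero ht.1 h] using ht' ht.2 (by omega)
      rcases Nat.eq_zero_or_pos t.totalDegree with h' | h'
      · simpa [GPRep.eval, t.eval_eq_zero ht.2 h'] using hs ht.1 (by omega)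
      obtain ⟨B, hB, hsB, htB⟩ := pair s t ht.1 ht.2 (by omega) (by omega)
      refine stable _ B hB ((hsB.add htB).mono ?_)
      exact Nat.mul_le_mul_right d (Nat.pow_le_pow_right two_pos D.le_succ)
    | neg s hs =>
      obtain ⟨B, hB, hsB⟩ := hs ht htD
      exact ⟨B, hB, hsB.neg⟩
    | mul s t hs ht' =>
      have hst : s.totalDegree + t.totalDegree ≤ D + 1 := htD
      rcases Nat.eq_zero_or_pos s.totalDegree with h | h
      · simpa [GPRep.eval, s.eval_eq_zero ht.1 h] using hs ht.1 (by omega)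
      rcases Nat.eq_zero_or_pos t.totalDegree with h' | h'
      · simpa [GPRep.eval, t.eval_eq_zero ht.2 h'] using ht' ht.2 (by omega)
      obtain ⟨B, hB, hsB, htB⟩ := pair s t ht.1 ht.2 (by omega) (by omega)
      refine stable _ B hB ((hsB.mul htB).mono (le_of_eq ?_))
      ring
    | floor s hs =>
      obtain ⟨B, hB, hsB⟩ := hs ht htD
      exact ⟨B, hB, hsB.floor'⟩

theorem mainTheorem5 (D d : ℕ) (ε : ℝ) (hε : 0 < ε) :
    ∃ r : ℕ, ∀ (l : ℕ) (ψ : (Fin l → ℤ) → ℝ),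
      IsOpenConstFreeGP ψ → IsConstFreeGPOfTotalDegreeLE D ψ →
        IsVIPStarSet d r {n : Fin l → ℤ | distToInt (ψ n) < ε} := by
  obtain ⟨m, hm⟩ := exists_subsystem_near_int (2 ^ D * d) 1 hε
  obtain ⟨r, hr⟩ := exists_isFloorStable_eval d D m
  refine ⟨r, fun l ψ _ ⟨t, ht, htD, htψ⟩ S ⟨φ, hφ, hφ0, hS⟩ => ?_⟩
  subst htψ hS
  obtain ⟨B, hB, hf⟩ := hr l t ht htD φ (fun i => (hφ.map
    ((Int.castAddHom ℝ).comp (Pi.evalAddMonoidHom _ i))).mem_polyDeg) hφ0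
  obtain ⟨c, u, hu, hu0, hcu⟩ := hf.self
  obtain ⟨B', hB', k, w, -, -, hwk, hwu⟩ := hm u hu hu0
  have hne : (Finset.univ : Finset (Fin 1)).Nonempty := Finset.univ_nonempty
  have hne' := hB'.biUnion_nonempty hne
  refine ⟨_, ?_, _, hB.biUnion_nonempty hne', rfl⟩
  refine lt_of_le_of_lt (Metric.infDist_le_dist_of_mem
    (Set.mem_range_self (c + (⌊u (Finset.univ.biUnion B')⌋ + k)))) ?_
  have h := hwu Finset.univ
  rw [hwk _ hne] at h
  have hval : t.eval (φ ((Finset.univ.biUnion B').biUnion B)) = c + u (Finset.univ.biUnion B') :=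
    hcu _ hne'
  rw [hval, Real.dist_eq]
  push_cast
  rwa [add_sub_add_left_eq_sub]
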